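/- For a permutation $\pi=\pi(1)\cdots\pi(n)\in\mathfrak S_n$ let $\mathrm{altdes}(\pi)$ be the number of positions $p\in\{1,\dots,n-1\}$ such that either $p$ is odd and $\pi(p)>\pi(p+1)$, or $p$ is even and $\pi(p)<\pi(p+1)$, and put $$\widehat A_n(x)=\sum_{\pi\in\mathfrak S_n}x^{\mathrm{altdes}(\pi)}.$$ Let $\mathcal S^B_n$ be the hyperoctahedral group, i.e. the group of permutations $\sigma$ of $\{\pm1,\dots,\pm n\}$ with $\sigma(-i)=-\sigma(i)$ for all $i$, and put $\sigma(0)=0$. Let $\mathrm{altdes}_B(\sigma)$ be the number of positions $p\in\{0,1,\dots,n-1\}$ such that either $p$ is even and $\sigma(p)<\sigma(p+1)$, or $p$ is odd and $\sigma(p)>\sigma(p+1)$, and put $$\widehat B_n(x)=\sum_{\sigma\in\mathcal S^B_n}x^{\mathrm{altdes}_B(\sigma)},\qquad \widehat B_0(x)=1.$$ Then for every integer $n\geq 1$ one has the polynomial identity $$\widehat B_{n+1}(x)=(1+x)\widehat B_n(x)+(1+x^2)\sum_{k=0}^{n-1}\binom nk 2^{\,n-k}\,\widehat B_k(x)\,\widehat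 A_{n-k}(x).$$ -/

import Mathlib

open Polynomial

/-- The number of alternating descents of a permutation `π = π(1)⋯π(n)`: positions `p ∈ {1, …, n-1}`
with `p` odd and `π(p) > π(p+1)`, or `p` even and `π(p) < π(p+1)`.
Positions and values are shifted down by one, so `i : Fin n` stands for the position `i + 1`
and the parity of the position is opposite to that of `i`. -/
def altDes {n : ℕ} (π : Equiv.Perm (Fin n)) : ℕ :=
  (Finset.univ.filter fun i : Fin n =>
    ∃ h : (i : ℕ) + 1 < n,
      (Even (i : ℕ) ∧ π i > π ⟨(i : ℕ) + 1, h⟩) ∨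
      (Odd (i : ℕ) ∧ π i < π ⟨(i : ℕ) + 1, h⟩)).card

/-- The alternating Eulerian polynomial of type A. -/
noncomputable def altEulerianA (n : ℕ) : ℤ[X] :=
  ∑ π : Equiv.Perm (Fin n), X ^ altDes π

/-- The set `{-n, …, -1, 0, 1, …, n}`. -/
abbrev SignedLetter (n : ℕ) : Type := Finset.Icc (-(n : ℤ)) (n : ℤ)

/-- The hyperoctahedral group of rank `n`, as the finite set of all permutations `σ` of
`{-n, …, -1, 0, 1, …, n}` with `σ(-i) = -σ(i)` for all `i` (which forces `σ(0) = 0`). -/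
noncomputable def signedPerms (n : ℕ) : Finset (Equiv.Perm (SignedLetter n)) :=
  Finset.univ.filter fun σ => ∀ i j : SignedLetter n,
    (j : ℤ) = -(i : ℤ) → (σ j : ℤ) = -(σ i : ℤ)

/-- The letters `σ(0), σ(1), …, σ(n)` of the word of a signed permutation. -/
def signedWord {n : ℕ} (σ : Equiv.Perm (SignedLetter n)) (p : Fin (n + 1)) : ℤ :=
  σ ⟨((p : ℕ) : ℤ), by
    have := p.isLt
    rw [Finset.mem_Icc]
    omega⟩

/-- The number of alternating descents of type B: positions `p ∈ {0, …, n-1}` with `p` even and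
`σ(p) < σ(p+1)`, or `p` odd and `σ(p) > σ(p+1)`. -/
def altDesB {n : ℕ} (σ : Equiv.Perm (SignedLetter n)) : ℕ :=
  (Finset.univ.filter fun p : Fin n =>
    (Even (p : ℕ) ∧ signedWord σ p.castSucc < signedWord σ p.succ) ∨
    (Odd (p : ℕ) ∧ signedWord σ p.castSucc > signedWord σ p.succ)).card

/-- The alternating Eulerian polynomial of type B. -/
noncomputable def altEulerianB (n : ℕ) : ℤ[X] :=
  ∑ σ ∈ signedPerms n, X ^ altDesB σ

/-!
Split a signed word on the absolute values `1, …, n + 1` at the letter `±(n + 1)`. If this letter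
comes last, exactly one of its two signs yields an additional alternating descent, which gives the
factor `1 + X` (`pow_altCount_append_extreme`). Otherwise it is a peak or a valley according to its
sign, and since neighbouring positions are counted with opposite conventions, one sign adds two
alternating descents and the other none, which gives `1 + X ^ 2`
(`exists_pow_altCount_append_extreme`).

The part in front is again a signed word, on a set of `k` absolute values. The part behind, of
length `n - k`, carries `2 ^ (n - k)` choices of signs; once these are chosen it is an arrangement
of a fixed set of integers, and such arrangements are counted by the type A polynomial whatever the
parity of the starting position, because reversing the order of the letters exchanges ascents and
descents (`sum_arrangements_pow_altCount`). Summing over the sets of absolute values in front yields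
`signedSum_insert`.

Words are encoded as lists. In place of standardizing signed words, the recursion itself is used to
show that their generating polynomial depends only on the number of letters
(`signedSum_eq_signedSum_Icc`); `altEulerianB_eq_signedSum` identifies it with the type B polynomial.
-/

/-! ### Alternating descents of lists -/

/-- The number of alternating descents of a word of integers, the first comparison being counted
when it is an ascent if `b = true`, and when it is a descent if `b = false`. -/
def altCount : Bool → List ℤ → ℕ
  | _, [] => 0
  | _, [_] => 0
  | b, a :: c :: l => (if (if b then a < c else c < a) then 1 else 0) + altCount (!b) (c :: l)

theorem altCount_not (b : Bool) (l : List ℤ) : altCount (!b) l = altCount b (l.map (-·)) := by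
  induction l generalizing b with
  | nil => rfl
  | cons a l ih =>
    cases l with
    | nil => rfl
    | cons c l =>
      have := ih (!b)
      simp only [List.map_cons] at this ⊢
      simp only [altCount, this]
      cases b <;> simp

theorem altCount_ofFn {n : ℕ} (b : Bool) (f : Fin (n + 1) → ℤ) :
    altCount b (List.ofFn f) =
      ∑ p : Fin n, if (if b ^^ decide (Odd (p : ℕ)) then f p.castSucc < f p.succ
        else f p.succ < f p.castSucc) then 1 else 0 := by
  induction n generalizing b with
  | zero => simp [altCount]
  | succ n ih =>
    have h := ih (!b) (fun i => f i.succ)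
    rw [List.ofFn_succ] at h ⊢
    rw [List.ofFn_succ, altCount, h, Fin.sum_univ_succ]
    congr 1
    · cases b <;> simp
    · refine Finset.sum_congr rfl fun p _ => ?_
      have : decide (Odd ((p.succ : Fin (n + 1)) : ℕ)) = !decide (Odd (p : ℕ)) := by
        by_cases h : Odd (p : ℕ) <;> simp [Nat.odd_add_one, h]
      rw [this]
      cases b <;> simp

/-- Ending the word with a letter `M` above all others and ending it with a letter `N` below all
others give one more comparison each, and exactly one of the two is counted. -/
theorem pow_altCount_append_extreme (b : Bool) (w : List ℤ) (hw : w ≠ []) (M N : ℤ)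
    (hM : ∀ c ∈ w, c < M) (hN : ∀ c ∈ w, N < c) :
    (X : ℤ[X]) ^ altCount b (w ++ [M]) + X ^ altCount b (w ++ [N]) =
      (1 + X) * X ^ altCount b w := by
  induction w generalizing b with
  | nil => exact absurd rfl hw
  | cons c w ih =>
    have h1 := hM c (by simp)
    have h2 := hN c (by simp)
    cases w with
    | nil => cases b <;> simp [altCount, h1, h2, h1.not_gt, h2.not_gt, add_comm]
    | cons d w =>
      have := ih (!b) (by simp) (fun x hx => hM x (by simp_all)) (fun x hx => hN x (by simp_all))
      simp only [List.cons_append, altCount, pow_add] at this ⊢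
      linear_combination X ^ (if (if b then c < d else d < c) then 1 else 0) * this

/-- Inside a word an extreme letter is a peak or a valley, so the two comparisons it takes part in
are both counted or both not counted, and the opposite happens for the other extreme: the factor is
`1 + X ^ 2`. The word splits there, and the direction `b'` in which the counting resumes depends
only on the part before the extreme letter. -/
theorem exists_pow_altCount_append_extreme (b : Bool) (w : List ℤ) (hw : w ≠ []) :
    ∃ b' : Bool, ∀ (M N : ℤ) (v : List ℤ), v ≠ [] → (∀ c ∈ w, c < M) → (∀ c ∈ w, N < c) →
      (∀ c ∈ v, c < M) → (∀ c ∈ v, N < c) →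
      (X : ℤ[X]) ^ altCount b (w ++ M :: v) + X ^ altCount b (w ++ N :: v) =
        (1 + X ^ 2) * (X ^ altCount b w * X ^ altCount b' v) := by
  induction w generalizing b with
  | nil => exact absurd rfl hw
  | cons c w ih =>
    cases w with
    | nil =>
      refine ⟨b, fun M N v hv hM hN hM' hN' => ?_⟩
      obtain ⟨d, v, rfl⟩ := List.exists_cons_of_ne_nil hv
      have h1 := hM c (by simp)
      have h2 := hN c (by simp)
      have h3 := hM' d (by simp)
      have h4 := hN' d (by simp)
      cases b <;>
        simp [altCount, h1, h2, h3, h4, h1.not_gt, h2.not_gt, h3.not_gt, h4.not_gt, pow_add] <;> ring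
    | cons d w =>
      obtain ⟨b', hb⟩ := ih (!b) (by simp)
      refine ⟨b', fun M N v hv hM hN hM' hN' => ?_⟩
      have := hb M N v hv (fun x hx => hM x (by simp_all)) (fun x hx => hN x (by simp_all)) hM' hN'
      simp only [List.cons_append, altCount, pow_add] at this ⊢
      linear_combination X ^ (if (if b then c < d else d < c) then 1 else 0) * this

/-! ### Arrangements of a finite set -/

/-- The arrangements of a finite set: the words in which each element occurs exactly once. -/
def arrangements {α : Type*} [DecidableEq α] (R : Finset α) : Finset (List α) :=
  R.val.lists.toFinset

theorem mem_arrangements {α : Type*} [DecidableEq α] {R : Finset α} {l : List α} :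
    l ∈ arrangements R ↔ l.Nodup ∧ l.toFinset = R := by
  rw [arrangements, Multiset.mem_toFinset, Multiset.mem_lists_iff]
  constructor
  · intro h
    have hn : l.Nodup := by
      have := R.nodup
      rw [h] at this
      exact this
    refine ⟨hn, ?_⟩
    apply Finset.val_injective
    rw [h, List.toFinset_val, hn.dedup]
    rfl
  · rintro ⟨hn, rfl⟩
    rw [List.toFinset_val, hn.dedup]
    rfl

/-- The arrangements of a finite set, enumerated by `e`, are the words `e (π 1) ⋯ e (π n)`. -/
theorem sum_arrangements_eq_sum_perm {α M : Type*} [DecidableEq α] [AddCommMonoid M] (R : Finset α)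
    {n : ℕ} (e : Fin n ≃ R) (g : List α → M) :
    ∑ l ∈ arrangements R, g l =
      ∑ π : Equiv.Perm (Fin n), g (List.ofFn fun i => (e (π i) : α)) := by
  symm
  refine Finset.sum_bij (fun π _ => List.ofFn fun i => (e (π i) : α)) ?_ ?_ ?_ (fun _ _ => rfl)
  · intro π _
    rw [mem_arrangements]
    refine ⟨List.nodup_ofFn.2 fun i j h => π.injective (e.injective (Subtype.ext h)), ?_⟩
    ext x
    rw [List.mem_toFinset, List.mem_ofFn]
    constructor
    · rintro ⟨i, rfl⟩
      exact (e (π i)).2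
    · intro hx
      exact ⟨π.symm (e.symm ⟨x, hx⟩), by simp⟩
  · intro π _ π' _ h
    ext1 i
    exact e.injective (Subtype.ext (congrFun (List.ofFn_injective h) i))
  · intro l hl
    rw [mem_arrangements] at hl
    obtain ⟨hn, rfl⟩ := hl
    have hlen : l.length = n := by
      have := Fintype.card_congr e
      rw [Fintype.card_fin, Fintype.card_coe, List.toFinset_card_of_nodup hn] at this
      exact this.symm
    subst hlen
    let f : Fin l.length → Fin l.length := fun i => e.symm ⟨l[i], by simp⟩
    have hf : Function.Injective f := by
      intro i j h
      have := congrArg Subtype.val (e.symm.injective h)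
      exact Fin.ext ((List.Nodup.getElem_inj_iff hn).1 this)
    refine ⟨Equiv.ofBijective f (Finite.injective_iff_bijective.1 hf), Finset.mem_univ _, ?_⟩
    simp [f]

theorem altDes_eq_altCount {n : ℕ} (π : Equiv.Perm (Fin n)) (f : Fin n → ℤ) (hf : StrictMono f) :
    altDes π = altCount false (List.ofFn fun i => f (π i)) := by
  cases n with
  | zero => simp [altDes, altCount]
  | succ n =>
    rw [altCount_ofFn, altDes, Finset.card_filter, Fin.sum_univ_castSucc, if_neg (by simp), add_zero]
    refine Finset.sum_congr rfl fun p _ => ?_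
    have hs : ∀ h, (⟨(p : ℕ) + 1, h⟩ : Fin (n + 1)) = p.succ := fun _ => rfl
    refine if_congr ?_ rfl rfl
    rcases Nat.even_or_odd (p : ℕ) with h | h
    · simp [h, Nat.not_odd_iff_even.2 h, hf.lt_iff_lt, hs]
    · simp [h, Nat.not_even_iff_odd.2 h, hf.lt_iff_lt, hs]

/-- The alternating Eulerian polynomial of type A counts the arrangements of any set `R` of letters
ordered through an injective `φ`, whichever way the first comparison is read: enumerating `R`
increasingly or decreasingly reduces to permutations. -/
theorem sum_arrangements_pow_altCount {α : Type*} [DecidableEq α] (R : Finset α) (φ : α → ℤ)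
    (hφ : Set.InjOn φ R) (b : Bool) :
    ∑ l ∈ arrangements R, (X : ℤ[X]) ^ altCount b (l.map φ) = altEulerianA R.card := by
  have key : ∀ φ : α → ℤ, Set.InjOn φ R →
      ∑ l ∈ arrangements R, (X : ℤ[X]) ^ altCount false (l.map φ) = altEulerianA R.card := by
    intro φ hφ
    let f : Fin R.card → ℤ := fun i => φ (R.equivFin.symm i)
    have hf : Function.Injective f := fun i j h =>
      R.equivFin.symm.injective (Subtype.ext (hφ (by simp) (by simp) h))
    have hmono : StrictMono (f ∘ Tuple.sort f) :=
      (Tuple.monotone_sort f).strictMono_of_injective (hf.comp (Tuple.sort f).injective)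
    rw [sum_arrangements_eq_sum_perm R ((Tuple.sort f).trans R.equivFin.symm), altEulerianA]
    refine Finset.sum_congr rfl fun π _ => ?_
    rw [altDes_eq_altCount π _ hmono, List.map_ofFn]
    rfl
  cases b with
  | false => exact key φ hφ
  | true =>
    rw [← key (fun x => -φ x) fun x hx y hy h => hφ hx hy (neg_injective h)]
    refine Finset.sum_congr rfl fun l _ => ?_
    rw [← Bool.not_false, altCount_not, List.map_map]
    rfl

/-- Arrangements of `insert m T` are obtained by placing `m` between an arrangement of a subset
of `T` and an arrangement of its complement. -/
theorem sum_arrangements_insert {α M : Type*} [DecidableEq α] [AddCommMonoid M] (T : Finset α)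
    (m : α) (hm : m ∉ T) (g : List α → M) :
    ∑ l ∈ arrangements (insert m T), g l =
      ∑ S ∈ T.powerset, ∑ u ∈ arrangements S, ∑ v ∈ arrangements (T \ S), g (u ++ m :: v) := by
  simp_rw [← Finset.sum_product', Finset.sum_sigma']
  symm
  refine Finset.sum_bij (fun x _ => x.2.1 ++ m :: x.2.2) ?_ ?_ ?_ (fun _ _ => rfl)
  · rintro ⟨S, u, v⟩ h
    simp only [Finset.mem_sigma, Finset.mem_powerset, Finset.mem_product, mem_arrangements] at h ⊢
    obtain ⟨hS, ⟨hu, rfl⟩, hv, hv'⟩ := h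
    have hv'' : ∀ x, x ∈ v ↔ x ∈ T ∧ x ∉ u := by
      intro x
      rw [← List.mem_toFinset, hv']
      simp
    have hu' : ∀ x ∈ u, x ∈ T := fun x hx => hS (by simpa using hx)
    constructor
    · simp only [List.nodup_append, List.nodup_cons, hu, hv, hv'']
      refine ⟨trivial, ⟨by tauto, trivial⟩, ?_⟩
      rintro a ha c hc rfl
      rw [List.mem_cons, hv''] at hc
      rcases hc with rfl | hc
      · exact hm (hu' _ ha)
      · exact hc.2 ha
    · ext x
      simp only [List.mem_toFinset, List.mem_append, List.mem_cons, hv'', Finset.mem_insert]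
      have := hu' x
      tauto
  · rintro ⟨S, u, v⟩ h ⟨S', u', v'⟩ h' heq
    simp only [Finset.mem_sigma, Finset.mem_powerset, Finset.mem_product, mem_arrangements] at h h'
    obtain ⟨hS, ⟨hu, rfl⟩, hv, hv'⟩ := h
    obtain ⟨hS', ⟨hu', rfl⟩, hw, hw'⟩ := h'
    have h1 : m ∉ u := fun h => hm (hS (by simpa using h))
    have h2 : m ∉ u' := fun h => hm (hS' (by simpa using h))
    have h3 : m ∉ v := fun h => by
      rw [← List.mem_toFinset, hv'] at h
      exact hm (Finset.mem_sdiff.1 h).1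
    have h4 : m ∉ v' := fun h => by
      rw [← List.mem_toFinset, hw'] at h
      exact hm (Finset.mem_sdiff.1 h).1
    obtain ⟨rfl, rfl⟩ : u = u' ∧ v = v' := by
      have := (List.append_cons_inj_of_notMem (by assumption) (by assumption)).1 heq
      tauto
    rfl
  · intro l hl
    rw [mem_arrangements] at hl
    obtain ⟨hn, hl⟩ := hl
    have hmem : m ∈ l := by
      rw [← List.mem_toFinset, hl]
      simp
    obtain ⟨u, v, rfl⟩ := List.append_of_mem hmem
    refine ⟨⟨u.toFinset, u, v⟩, ?_, rfl⟩
    simp only [Finset.mem_sigma, Finset.mem_powerset, Finset.mem_product, mem_arrangements]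
    simp only [List.nodup_append, List.nodup_cons] at hn
    obtain ⟨hu, ⟨hmv, hv⟩, hd⟩ := hn
    have hT : ∀ x, x ∈ T ↔ x ∈ u ∨ x ∈ v := by
      intro x
      have h1 : x ∈ u ∨ x = m ∨ x ∈ v ↔ x = m ∨ x ∈ T := by
        have := Finset.ext_iff.1 hl x
        simp only [List.mem_toFinset, List.mem_append, List.mem_cons, Finset.mem_insert] at this
        exact this
      have h2 : m ∉ u := fun h => hd m h m (by simp) rfl
      rcases eq_or_ne x m with rfl | hx
      · tauto
      · tauto
    refine ⟨fun x hx => (hT x).2 (Or.inl (by simpa using hx)), ⟨hu, trivial⟩, hv, ?_⟩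
    ext x
    simp only [List.mem_toFinset, Finset.mem_sdiff, hT]
    have : x ∈ u → x ∈ v → False := fun h1 h2 => hd x h1 x (by simp [h2]) rfl
    tauto

theorem sum_powerset_eq_sum_powerset_sdiff {α M : Type*} [DecidableEq α] [AddCommMonoid M]
    {S T : Finset α} (hS : S ⊆ T) (g : Finset α → M) :
    ∑ s ∈ T.powerset, g s = ∑ s ∈ S.powerset, ∑ t ∈ (T \ S).powerset, g (s ∪ t) := by
  rw [← Finset.sum_product']
  symm
  refine Finset.sum_bij' (fun x _ => x.1 ∪ x.2) (fun s _ => (s ∩ S, s \ S)) ?_ ?_ ?_ ?_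
    (fun _ _ => rfl)
  · rintro ⟨s, t⟩ h
    simp only [Finset.mem_product, Finset.mem_powerset] at h ⊢
    exact Finset.union_subset (h.1.trans hS) (h.2.trans Finset.sdiff_subset)
  · intro s h
    simp only [Finset.mem_product, Finset.mem_powerset] at h ⊢
    exact ⟨Finset.inter_subset_right, Finset.sdiff_subset_sdiff h le_rfl⟩
  · rintro ⟨s, t⟩ h
    simp only [Finset.mem_product, Finset.mem_powerset] at h ⊢
    ext x
    all_goals
      have h1 := @h.1 x
      have h2 := @h.2 x
      simp only [Finset.mem_sdiff, Finset.mem_inter, Finset.mem_union] at *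
      tauto
  · intro s h
    ext x
    simp only [Finset.mem_sdiff, Finset.mem_inter, Finset.mem_union]
    tauto

/-! ### Signed words on a set of absolute values -/

/-- The letter `x` of a signed word, negated if `x` lies in the set `s` of negated letters. -/
def signLetter (s : Finset ℕ) (x : ℕ) : ℤ := if x ∈ s then -x else x

theorem natAbs_signLetter (s : Finset ℕ) (x : ℕ) : (signLetter s x).natAbs = x := by
  unfold signLetter
  split_ifs <;> simp

theorem signLetter_injective (s : Finset ℕ) : Function.Injective (signLetter s) := fun x y h => by
  rw [← natAbs_signLetter s x, h, natAbs_signLetter]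

/-- The type B alternating descent polynomial of the signed words on a set `T` of absolute values:
a signed word is an arrangement of `T` together with the set of the letters to be negated, and is
read with a letter `0` in front. -/
noncomputable def signedSum (T : Finset ℕ) : ℤ[X] :=
  ∑ l ∈ arrangements T, ∑ s ∈ T.powerset, X ^ altCount true (0 :: l.map (signLetter s))

theorem arrangements_empty {α : Type*} [DecidableEq α] :
    arrangements (∅ : Finset α) = {[]} := by
  ext l
  rw [mem_arrangements]
  simp only [List.toFinset_eq_empty_iff, Finset.mem_singleton]
  constructor
  · exact fun h => h.2
  · rintro rfl
    simp

theorem mem_of_mem_arrangements {α : Type*} [DecidableEq α] {R : Finset α} {l : List α}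
    (h : l ∈ arrangements R) {x : α} : x ∈ l ↔ x ∈ R := by
  rw [← (mem_arrangements.1 h).2, List.mem_toFinset]

/-- The signed words on `insert m T`, with `m` larger than all of `T`, sorted according to the set
`S` of absolute values in front of `±m`. -/
theorem signedSum_insert (T : Finset ℕ) (m : ℕ) (hm : ∀ x ∈ T, x < m) (hpos : 0 < m) :
    signedSum (insert m T) = ∑ S ∈ T.powerset,
      if S = T then (1 + X) * signedSum S
      else (1 + X ^ 2) * (signedSum S *
        (2 ^ (T \ S).card * altEulerianA (T \ S).card)) := by
  have hmT : m ∉ T := fun h => (hm m h).false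
  rw [signedSum, sum_arrangements_insert T m hmT]
  refine Finset.sum_congr rfl fun S hS => ?_
  rw [Finset.mem_powerset] at hS
  have hbound : ∀ (t : Finset ℕ) (l : List ℕ), (∀ x ∈ l, x ∈ T) →
      (∀ c ∈ l.map (signLetter t), c < (m : ℤ)) ∧ (∀ c ∈ l.map (signLetter t), -(m : ℤ) < c) := by
    intro t l hl
    simp only [List.mem_map]
    constructor <;> rintro c ⟨x, hx, rfl⟩ <;>
    · have h1 := hm x (hl x hx)
      have h2 := natAbs_signLetter t x
      omega
  have hsplit : ∀ u ∈ arrangements S, ∀ v ∈ arrangements (T \ S), ∀ s ∈ S.powerset,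
      ∀ t ∈ (T \ S).powerset,
      (u ++ m :: v).map (signLetter (s ∪ t)) =
        u.map (signLetter s) ++ (m : ℤ) :: v.map (signLetter t) ∧
      (u ++ m :: v).map (signLetter (insert m (s ∪ t))) =
        u.map (signLetter s) ++ (-m : ℤ) :: v.map (signLetter t) := by
    intro u hu v hv s hs t ht
    rw [Finset.mem_powerset] at hs ht
    have hms : m ∉ s := fun h => hmT (hS (hs h))
    have hmt : m ∉ t := fun h => hmT (Finset.mem_sdiff.1 (ht h)).1
    have hu' : ∀ x ∈ u, x ∉ t ∧ x ≠ m := fun x hx => by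
      rw [mem_of_mem_arrangements hu] at hx
      exact ⟨fun h => (Finset.mem_sdiff.1 (ht h)).2 hx, (hm x (hS hx)).ne⟩
    have hv' : ∀ x ∈ v, x ∉ s ∧ x ≠ m := fun x hx => by
      rw [mem_of_mem_arrangements hv, Finset.mem_sdiff] at hx
      exact ⟨fun h => hx.2 (hs h), (hm x hx.1).ne⟩
    simp only [List.map_append, List.map_cons]
    refine ⟨congrArg₂ _ (List.map_congr_left fun x hx => ?_)
      (congrArg₂ _ ?_ (List.map_congr_left fun x hx => ?_)),
      congrArg₂ _ (List.map_congr_left fun x hx => ?_)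
      (congrArg₂ _ ?_ (List.map_congr_left fun x hx => ?_))⟩
    · simp [signLetter, hu' x hx]
    · simp [signLetter, hms, hmt]
    · simp [signLetter, hv' x hx]
    · simp [signLetter, hu' x hx]
    · simp [signLetter]
    · simp [signLetter, hv' x hx]
  have hsum : ∑ u ∈ arrangements S, ∑ v ∈ arrangements (T \ S), ∑ s ∈ (insert m T).powerset,
        (X : ℤ[X]) ^ altCount true (0 :: (u ++ m :: v).map (signLetter s)) =
      ∑ u ∈ arrangements S, ∑ s ∈ S.powerset,
        ∑ t ∈ (T \ S).powerset, ∑ v ∈ arrangements (T \ S),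
          (X ^ altCount true ((0 :: u.map (signLetter s)) ++ (m : ℤ) :: v.map (signLetter t)) +
          X ^ altCount true ((0 :: u.map (signLetter s)) ++ (-m : ℤ) :: v.map (signLetter t))) := by
    refine Finset.sum_congr rfl fun u hu => ?_
    have : ∀ v ∈ arrangements (T \ S), ∑ s ∈ (insert m T).powerset,
        (X : ℤ[X]) ^ altCount true (0 :: (u ++ m :: v).map (signLetter s)) =
        ∑ s ∈ S.powerset, ∑ t ∈ (T \ S).powerset,
          (X ^ altCount true ((0 :: u.map (signLetter s)) ++ (m : ℤ) :: v.map (signLetter t)) +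
          X ^ altCount true ((0 :: u.map (signLetter s)) ++ (-m : ℤ) :: v.map (signLetter t))) := by
      intro v hv
      rw [Finset.sum_powerset_insert hmT, ← Finset.sum_add_distrib,
        sum_powerset_eq_sum_powerset_sdiff hS]
      refine Finset.sum_congr rfl fun s hs => Finset.sum_congr rfl fun t ht => ?_
      rw [(hsplit u hu v hv s hs t ht).1, (hsplit u hu v hv s hs t ht).2]
      rfl
    rw [Finset.sum_congr rfl this, Finset.sum_comm]
    exact Finset.sum_congr rfl fun s _ => Finset.sum_comm
  have hub : ∀ u ∈ arrangements S, ∀ s : Finset ℕ,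
      (∀ c ∈ (0 : ℤ) :: u.map (signLetter s), c < (m : ℤ)) ∧
      (∀ c ∈ (0 : ℤ) :: u.map (signLetter s), -(m : ℤ) < c) := by
    intro u hu s
    have := hbound s u fun x hx => hS ((mem_of_mem_arrangements hu).1 hx)
    simp only [List.forall_mem_cons]
    exact ⟨⟨by omega, this.1⟩, ⟨by omega, this.2⟩⟩
  rw [hsum]
  split_ifs with hST
  · subst hST
    rw [signedSum, Finset.mul_sum]
    refine Finset.sum_congr rfl fun u hu => ?_
    rw [Finset.mul_sum]
    refine Finset.sum_congr rfl fun s _ => ?_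
    rw [Finset.sdiff_self, arrangements_empty, Finset.powerset_empty, Finset.sum_singleton,
      Finset.sum_singleton]
    exact pow_altCount_append_extreme true _ (by simp) _ _ (hub u hu s).1 (hub u hu s).2
  · rw [signedSum, Finset.sum_mul, Finset.mul_sum]
    refine Finset.sum_congr rfl fun u hu => ?_
    rw [Finset.sum_mul, Finset.mul_sum]
    refine Finset.sum_congr rfl fun s _ => ?_
    -- The direction `b'` is the same for all words `v` behind `±m` and all their signs.
    obtain ⟨b', hb⟩ := exists_pow_altCount_append_extreme true
      ((0 : ℤ) :: u.map (signLetter s)) (by simp)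
    have : ∀ t ∈ (T \ S).powerset, ∑ v ∈ arrangements (T \ S),
          ((X : ℤ[X]) ^ altCount true
              ((0 :: u.map (signLetter s)) ++ (m : ℤ) :: v.map (signLetter t)) +
          X ^ altCount true ((0 :: u.map (signLetter s)) ++ (-m : ℤ) :: v.map (signLetter t))) =
        (1 + X ^ 2) * (X ^ altCount true ((0 : ℤ) :: u.map (signLetter s)) *
          altEulerianA (T \ S).card) := by
      intro t _
      rw [← sum_arrangements_pow_altCount (T \ S) (signLetter t)
        ((signLetter_injective t).injOn) b', Finset.mul_sum, Finset.mul_sum]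
      refine Finset.sum_congr rfl fun v hv => ?_
      have hv' := hbound t v fun x hx =>
        (Finset.mem_sdiff.1 ((mem_of_mem_arrangements hv).1 hx)).1
      refine hb _ _ _ ?_ (hub u hu s).1 (hub u hu s).2 hv'.1 hv'.2
      intro h
      rw [List.map_eq_nil_iff] at h
      subst h
      have := (mem_arrangements.1 hv).2
      rw [List.toFinset_nil] at this
      exact hST (hS.antisymm (Finset.sdiff_eq_empty_iff_subset.1 this.symm))
    rw [Finset.sum_congr rfl this, Finset.sum_const, Finset.card_powerset, nsmul_eq_mul]
    push_cast
    ring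

/-- The recursion, for a set `T` on whose subsets `signedSum` depends only on the cardinality. -/
theorem signedSum_insert_of_forall (T : Finset ℕ) (m : ℕ) (hm : ∀ x ∈ T, x < m) (hpos : 0 < m)
    (hT : ∀ S ⊆ T, signedSum S = signedSum (Finset.Icc 1 S.card)) :
    signedSum (insert m T) = (1 + X) * signedSum (Finset.Icc 1 T.card) +
      (1 + X ^ 2) * ∑ k ∈ Finset.range T.card,
        (T.card.choose k : ℤ[X]) * 2 ^ (T.card - k) * signedSum (Finset.Icc 1 k) *
          altEulerianA (T.card - k) := by
  -- The summand of `signedSum_insert` as a function of the cardinality of `S` alone.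
  let F : ℕ → ℤ[X] := fun k => if k = T.card then (1 + X) * signedSum (Finset.Icc 1 k)
    else (1 + X ^ 2) * (signedSum (Finset.Icc 1 k) *
      (2 ^ (T.card - k) * altEulerianA (T.card - k)))
  have hF : signedSum (insert m T) = ∑ S ∈ T.powerset, F S.card := by
    rw [signedSum_insert T m hm hpos]
    refine Finset.sum_congr rfl fun S hS => ?_
    rw [Finset.mem_powerset] at hS
    have hiff : S = T ↔ S.card = T.card :=
      ⟨congrArg _, fun h => Finset.eq_of_subset_of_card_le hS h.ge⟩
    simp only [F, hiff, hT S hS, Finset.card_sdiff_of_subset hS]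
  rw [hF, Finset.sum_powerset_apply_card, Finset.sum_range_succ, add_comm, Finset.mul_sum]
  congr 1
  · simp [F]
  · refine Finset.sum_congr rfl fun k hk => ?_
    simp only [F, (Finset.mem_range.1 hk).ne, if_false, nsmul_eq_mul]
    ring

theorem Icc_one_succ_eq_insert (n : ℕ) :
    Finset.Icc 1 (n + 1) = insert (n + 1) (Finset.Icc 1 n) := by
  ext x
  simp only [Finset.mem_Icc, Finset.mem_insert]
  omega

/-- The generating polynomial of signed words depends only on the number of absolute values: by
induction, both sides satisfy the same recursion. -/
theorem signedSum_eq_signedSum_Icc (T : Finset ℕ) (h0 : 0 ∉ T) :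
    signedSum T = signedSum (Finset.Icc 1 T.card) := by
  induction hn : T.card using Nat.strong_induction_on generalizing T with
  | _ n ih =>
    subst hn
    rcases T.eq_empty_or_nonempty with rfl | hne
    · simp
    set m := T.max' hne with hmdef
    have hmT : m ∈ T := T.max'_mem hne
    have hcard : (T.erase m).card + 1 = T.card := Finset.card_erase_add_one hmT
    have hIH : ∀ U : Finset ℕ, 0 ∉ U → U.card + 1 = T.card →
        ∀ S ⊆ U, signedSum S = signedSum (Finset.Icc 1 S.card) := fun U hU hUT S hS =>
      ih S.card (by have := Finset.card_le_card hS; omega) S (fun h => hU (hS h)) rfl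
    have h1 := signedSum_insert_of_forall (T.erase m) m
      (fun x hx => lt_of_le_of_ne (T.le_max' x (Finset.mem_of_mem_erase hx))
        (Finset.ne_of_mem_erase hx))
      (Nat.pos_of_ne_zero fun h => h0 (h ▸ hmT))
      (hIH _ (fun h => h0 (Finset.mem_of_mem_erase h)) hcard)
    have h2 := signedSum_insert_of_forall (Finset.Icc 1 (T.erase m).card) ((T.erase m).card + 1)
      (fun x hx => by rw [Finset.mem_Icc] at hx; omega) (Nat.succ_pos _)
      (hIH _ (by simp) (by simpa using hcard))
    rw [Finset.insert_erase hmT] at h1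
    rw [← Icc_one_succ_eq_insert, hcard] at h2
    rw [h1, h2]
    simp

/-! ### Signed permutations as signed words -/

theorem signedWord_zero {n : ℕ} {σ : Equiv.Perm (SignedLetter n)} (hσ : σ ∈ signedPerms n) :
    signedWord σ 0 = 0 := by
  have h := (Finset.mem_filter.1 hσ).2 ⟨0, by simp⟩ ⟨0, by simp⟩ (by simp)
  have : (σ ⟨0, by simp⟩ : ℤ) = 0 := by omega
  simpa [signedWord] using this

theorem altDesB_eq_altCount {n : ℕ} {σ : Equiv.Perm (SignedLetter n)} (hσ : σ ∈ signedPerms n) :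
    altDesB σ = altCount true (0 :: List.ofFn fun i : Fin n => signedWord σ i.succ) := by
  have h : (0 :: List.ofFn fun i : Fin n => signedWord σ i.succ) = List.ofFn (signedWord σ) := by
    rw [List.ofFn_succ, signedWord_zero hσ]
  rw [h, altCount_ofFn, altDesB, Finset.card_filter]
  refine Finset.sum_congr rfl fun p _ => if_congr ?_ rfl rfl
  rcases Nat.even_or_odd (p : ℕ) with h' | h' <;> simp [h']

/-- The word of a signed permutation has distinct absolute values. -/
theorem natAbs_signedWord_injective {n : ℕ} {σ : Equiv.Perm (SignedLetter n)}
    (hσ : σ ∈ signedPerms n) :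
    Function.Injective fun p : Fin (n + 1) => (signedWord σ p).natAbs := by
  intro p q h
  rcases Int.natAbs_eq_natAbs_iff.1 h with h | h
  · have := congrArg Subtype.val (σ.injective (Subtype.ext h))
    exact Fin.ext (by simpa using this)
  · have hq := q.isLt
    have h1 := (Finset.mem_filter.1 hσ).2 ⟨((q : ℕ) : ℤ), by rw [Finset.mem_Icc]; omega⟩
      ⟨-((q : ℕ) : ℤ), by rw [Finset.mem_Icc]; omega⟩ rfl
    have := congrArg Subtype.val (σ.injective (Subtype.ext (h.trans h1.symm)))
    simp only at this
    exact Fin.ext (by omega)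

theorem eq_of_signedWord_succ_eq {n : ℕ} {σ τ : Equiv.Perm (SignedLetter n)}
    (hσ : σ ∈ signedPerms n) (hτ : τ ∈ signedPerms n)
    (h : ∀ i : Fin n, signedWord σ i.succ = signedWord τ i.succ) : σ = τ := by
  have h' : ∀ p : Fin (n + 1), signedWord σ p = signedWord τ p := by
    intro p
    cases p using Fin.cases with
    | zero => rw [signedWord_zero hσ, signedWord_zero hτ]
    | succ i => exact h i
  have hnonneg : ∀ (k : ℕ) (hk : (k : ℤ) ∈ Finset.Icc (-(n : ℤ)) n),
      (σ ⟨k, hk⟩ : ℤ) = τ ⟨k, hk⟩ := fun k hk =>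
    h' ⟨k, by rw [Finset.mem_Icc] at hk; omega⟩
  ext ⟨x, hx⟩
  obtain ⟨k, rfl | rfl⟩ := x.eq_nat_or_neg
  · exact hnonneg k hx
  · have hk : (k : ℤ) ∈ Finset.Icc (-(n : ℤ)) n := by
      rw [Finset.mem_Icc] at hx ⊢
      omega
    rw [(Finset.mem_filter.1 hσ).2 ⟨k, hk⟩ ⟨-k, hx⟩ rfl,
      (Finset.mem_filter.1 hτ).2 ⟨k, hk⟩ ⟨-k, hx⟩ rfl, hnonneg k hk]

/-- Every word whose absolute values are `1, …, n` in some order is the word of a signed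
permutation, namely of its odd extension. -/
theorem exists_signedWord_eq {n : ℕ} (w : Fin n → ℤ)
    (hw : ∀ i, w i ≠ 0 ∧ (w i).natAbs ≤ n) (hinj : Function.Injective fun i => (w i).natAbs) :
    ∃ σ ∈ signedPerms n, ∀ i : Fin n, signedWord σ i.succ = w i := by
  -- At `x = 0` the sign vanishes, so the letter `w 0` that the subtraction picks is irrelevant.
  let a : ℤ → ℤ := fun x =>
    if h : x.natAbs - 1 < n then x.sign * w ⟨x.natAbs - 1, h⟩ else 0
  have hneg : ∀ x, a (-x) = -a x := by
    intro x
    simp only [a, Int.natAbs_neg, Int.sign_neg]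
    split_ifs <;> simp
  have hlt : ∀ x : SignedLetter n, (x : ℤ) ≠ 0 → (x : ℤ).natAbs - 1 < n := by
    rintro ⟨x, hx⟩ h
    rw [Finset.mem_Icc] at hx
    simp only at h ⊢
    omega
  have habs : ∀ (x : SignedLetter n) (h : (x : ℤ) ≠ 0),
      (a x).natAbs = (w ⟨(x : ℤ).natAbs - 1, hlt x h⟩).natAbs := by
    intro x h
    simp only [a, hlt x h, dif_pos, Int.natAbs_mul, Int.natAbs_sign_of_ne_zero h, one_mul]
  have h0 : a 0 = 0 := by simp [a]
  have hmem : ∀ x : SignedLetter n, a x ∈ Finset.Icc (-(n : ℤ)) n := by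
    intro x
    rw [Finset.mem_Icc]
    by_cases h : (x : ℤ) = 0
    · rw [h, h0]
      omega
    · have h1 := habs x h
      have h2 := (hw ⟨(x : ℤ).natAbs - 1, hlt x h⟩).2
      omega
  have hne : ∀ x : SignedLetter n, (x : ℤ) ≠ 0 → a x ≠ 0 := by
    intro x h h'
    have h1 := habs x h
    have h2 := (hw ⟨(x : ℤ).natAbs - 1, hlt x h⟩).1
    rw [h'] at h1
    omega
  let g : SignedLetter n → SignedLetter n := fun x => ⟨a x, hmem x⟩
  have hg : Function.Injective g := by
    intro x y hxy
    have hxy' : a x = a y := congrArg Subtype.val hxy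
    by_cases hx : (x : ℤ) = 0
    · by_cases hy : (y : ℤ) = 0
      · exact Subtype.ext (hx.trans hy.symm)
      · rw [hx, h0] at hxy'
        exact absurd hxy'.symm (hne y hy)
    · by_cases hy : (y : ℤ) = 0
      · rw [hy, h0] at hxy'
        exact absurd hxy' (hne x hx)
      · have h1 : (w ⟨(x : ℤ).natAbs - 1, hlt x hx⟩).natAbs =
            (w ⟨(y : ℤ).natAbs - 1, hlt y hy⟩).natAbs := by
          rw [← habs x hx, ← habs y hy, hxy']
        have h2 := congrArg Fin.val (hinj h1)
        simp only at h2
        have h3 : (x : ℤ).natAbs = (y : ℤ).natAbs := by omega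
        rcases Int.natAbs_eq_natAbs_iff.1 h3 with h | h
        · exact Subtype.ext h
        · rw [h, hneg] at hxy'
          have := hne y hy
          omega
  refine ⟨Equiv.ofBijective g (Finite.injective_iff_bijective.1 hg), ?_, fun i => ?_⟩
  · rw [signedPerms, Finset.mem_filter]
    refine ⟨Finset.mem_univ _, fun i j hij => ?_⟩
    simp only [Equiv.ofBijective_apply, g, hij, hneg]
  · simp only [signedWord, Equiv.ofBijective_apply, g, a]
    have h1 : (((i.succ : Fin (n + 1)) : ℕ) : ℤ).natAbs - 1 = i := by
      rw [Int.natAbs_natCast, Fin.val_succ, Nat.add_sub_cancel]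
    have h2 : (((i.succ : Fin (n + 1)) : ℕ) : ℤ).sign = 1 :=
      Int.sign_eq_one_of_pos (by simp)
    simp only [h1, h2, i.isLt, dif_pos, one_mul]

/-- A signed permutation is recorded by the absolute values of its word and the set of the letters
that are negated in it. -/
theorem altEulerianB_eq_signedSum (n : ℕ) : altEulerianB n = signedSum (Finset.Icc 1 n) := by
  rw [signedSum, ← Finset.sum_product', altEulerianB]
  let absWord : Equiv.Perm (SignedLetter n) → List ℕ := fun σ =>
    List.ofFn fun i : Fin n => (signedWord σ i.succ).natAbs
  let negSet : Equiv.Perm (SignedLetter n) → Finset ℕ := fun σ =>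
    (Finset.Icc 1 n).filter fun x => ∃ i : Fin n, signedWord σ i.succ = -x
  have hrange : ∀ σ ∈ signedPerms n, ∀ i : Fin n,
      (signedWord σ i.succ).natAbs ∈ Finset.Icc 1 n := by
    intro σ hσ i
    have h1 : signedWord σ i.succ ∈ Finset.Icc (-(n : ℤ)) n := Subtype.property _
    have h2 := (natAbs_signedWord_injective hσ).ne (Fin.succ_ne_zero i)
    simp only [signedWord_zero hσ] at h2
    rw [Finset.mem_Icc] at h1 ⊢
    omega
  have hword : ∀ σ ∈ signedPerms n, (absWord σ).map (signLetter (negSet σ)) =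
      List.ofFn fun i : Fin n => signedWord σ i.succ := by
    intro σ hσ
    rw [List.map_ofFn]
    congr 1
    funext i
    have hr := hrange σ hσ i
    simp only [Function.comp_apply, signLetter, negSet, Finset.mem_filter, hr, true_and]
    split_ifs with h
    · obtain ⟨j, hj⟩ := h
      have : j.succ = i.succ := natAbs_signedWord_injective hσ (by
        simp only [hj, Int.natAbs_neg, Int.natAbs_natCast])
      rw [this] at hj
      exact hj.symm
    · have : signedWord σ i.succ ≠ -((signedWord σ i.succ).natAbs : ℤ) := fun h' => h ⟨i, h'⟩
      omega
  refine Finset.sum_bij (fun σ _ => (absWord σ, negSet σ)) ?_ ?_ ?_ ?_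
  · intro σ hσ
    rw [Finset.mem_product, Finset.mem_powerset, mem_arrangements]
    have hnodup : (absWord σ).Nodup := List.nodup_ofFn.2
      ((natAbs_signedWord_injective hσ).comp (Fin.succ_injective n))
    refine ⟨⟨hnodup, Finset.eq_of_subset_of_card_le ?_ ?_⟩, Finset.filter_subset _ _⟩
    · intro x hx
      rw [List.mem_toFinset, List.mem_ofFn] at hx
      obtain ⟨i, rfl⟩ := hx
      exact hrange σ hσ i
    · rw [List.toFinset_card_of_nodup hnodup]
      simp [absWord]
  · intro σ hσ τ hτ h
    rw [Prod.mk.injEq] at h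
    have h1 := hword σ hσ
    rw [h.1, h.2, hword τ hτ] at h1
    exact eq_of_signedWord_succ_eq hσ hτ fun i => (congrFun (List.ofFn_injective h1) i).symm
  · rintro ⟨l, s⟩ hls
    rw [Finset.mem_product, Finset.mem_powerset, mem_arrangements] at hls
    obtain ⟨⟨hn, hl⟩, hs⟩ := hls
    simp only at hn hl hs
    have hlen : l.length = n := by
      rw [← List.toFinset_card_of_nodup hn, hl]
      simp
    have hmem : ∀ x, x ∈ l ↔ x ∈ Finset.Icc 1 n := fun x => by rw [← hl, List.mem_toFinset]
    obtain ⟨σ, hσ, hσw⟩ := exists_signedWord_eq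
      (fun i : Fin n => signLetter s (l[(i : ℕ)]'(by omega))) (fun i => by
        have h1 := (hmem _).1 (List.getElem_mem (l := l) (n := i) (by omega))
        have h2 := natAbs_signLetter s (l[(i : ℕ)]'(by omega))
        rw [Finset.mem_Icc] at h1
        constructor
        · intro h
          rw [h] at h2
          simp at h2
          omega
        · omega) (fun i j h => by
        simp only [natAbs_signLetter] at h
        exact Fin.ext ((List.Nodup.getElem_inj_iff hn).1 h))
    have habs : absWord σ = l := by
      apply List.ext_getElem
      · simp [absWord, hlen]
      · intro i h1 h2
        simp [absWord, hσw, natAbs_signLetter]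
    refine ⟨σ, hσ, Prod.ext habs ?_⟩
    ext x
    simp only [negSet, Finset.mem_filter, hσw]
    constructor
    · rintro ⟨hx, i, hi⟩
      have hx' := natAbs_signLetter s (l[(i : ℕ)]'(by omega))
      rw [hi] at hx'
      simp only [Int.natAbs_neg, Int.natAbs_natCast] at hx'
      rw [← hx', signLetter] at hi
      rw [Finset.mem_Icc] at hx
      by_contra hxs
      rw [if_neg hxs] at hi
      omega
    · intro hx
      refine ⟨hs hx, ?_⟩
      obtain ⟨i, hi, rfl⟩ := List.getElem_of_mem ((hmem x).2 (hs hx))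
      exact ⟨⟨i, by omega⟩, if_pos hx⟩
  · intro σ hσ
    rw [hword σ hσ, altDesB_eq_altCount hσ]

theorem mainTheorem9 (n : ℕ) (hn : 1 ≤ n) :
    altEulerianB (n + 1) = (1 + X) * altEulerianB n +
      (1 + X ^ 2) * ∑ k ∈ Finset.range n,
        (n.choose k : ℤ[X]) * 2 ^ (n - k) * altEulerianB k * altEulerianA (n - k) := by
  simp only [altEulerianB_eq_signedSum]
  have h := signedSum_insert_of_forall (Finset.Icc 1 n) (n + 1)
    (fun x hx => by rw [Finset.mem_Icc] at hx; omega) (Nat.succ_pos n)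
    (fun S hS => signedSum_eq_signedSum_Icc S fun h0 => by simpa using hS h0)
  rw [← Icc_one_succ_eq_insert] at h
  simpa only [Nat.card_Icc, Nat.add_sub_cancel] using h
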